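/- For a map $f\colon \mathbb{Z}_3^n\to\mathbb{Z}_3$, the $i$-th variable is called essential in $f$ if there are two tuples differing only in their $i$-th component on which $f$ takes different values; $\operatorname{Ess} f$ is the set of indices of essential variables and $\operatorname{ess} f=|\operatorname{Ess} f|$. For $i\neq j$ let $f_{i\leftarrow j}(x_1,\dots,x_n)=f(x_1,\dots,x_{i-1},x_j,x_{i+1},\dots,x_n)$. The arity gap of $f$ is $$\operatorname{gap} f=\min_{i,j\in\operatorname{Ess} f,\ i\neq j}\bigl(\operatorname{ess} f-\operatorname{ess} f_{i\leftarrow j}\bigr).$$ Let $\oplus$ denote symmetric difference on the power set $\mathcal{P}(\mathbb{Z}_3)$, and identify each $a\in\mathbb{Z}_3$ with the one-element set $\{a\}$; the operations $+,-,\cdot$ are those of the field $\mathbb{Z}_3$. **Theorem.** Let $n\ge 4$ and let $f\colon\mathbb{Z}_3^n\to\mathbb{Z}_3$ be a function that depends on all of its variables (that is, $\operatorname{ess} f=n$). Then $\operatorname{gap} f=2$ if and only if there exist a polynomial $p=ax^2+bx+c\in\mathbb{Z}_3[x]$ (with $a,b,c\in\mathbb{Z}_3$, where $a=0$ is allowed)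 and a constant $d\in\mathbb{Z}_3$ such that for all $\mathbf{x}=(x_1,\dots,x_n)\in\mathbb{Z}_3^n$ $$f(\mathbf{x})=\bigoplus_{i<j}\bigl((x_i-x_j)^2p(x_i+x_j)+d\bigr)\oplus d\quad\text{if } n\equiv 0 \pmod 4,$$ $$f(\mathbf{x})=\bigoplus_{i<j}\bigl((x_i-x_j)^2p(x_i+x_j)+d\bigr)\oplus\bigoplus_{i}\bigl(p(x_i)+d\bigr)\quad\text{if } n\equiv 1 \pmod 4,$$ $$f(\mathbf{x})=\bigoplus_{i<j}\bigl((x_i-x_j)^2p(x_i+x_j)+d\bigr)\quad\text{if } n\equiv 2 \pmod 4,$$ $$f(\mathbf{x})=\bigoplus_{i<j}\bigl((x_i-x_j)^2p(x_i+x_j)+d\bigr)\oplus\bigoplus_{i}\bigl(p(x_i)+d\bigr)\oplus d\quad\text{if } n\equiv 3 \pmod 4,$$ where $i,j$ run over $\{1,\dots,n\}$. The polynomial $p$ and the constant $d$ are uniquely determined by $f$ whenever they exist. If $\operatorname{gap} f\neq 2$, then $\operatorname{gap} f=1$. -/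

import Mathlib

open scoped symmDiff

namespace ArityGap

/-- The `i`-th variable is essential in `f : A ^ n → B`: two tuples that differ at most in their
`i`-th component have different values. -/
def IsEssential {A B : Type*} {n : ℕ} (f : (Fin n → A) → B) (i : Fin n) : Prop :=
  ∃ (x : Fin n → A) (a : A), f x ≠ f (Function.update x i a)

/-- The set of (indices of) essential variables of `f`. -/
def essSet {A B : Type*} {n : ℕ} (f : (Fin n → A) → B) : Set (Fin n) :=
  {i | IsEssential f i}

/-- The essential arity of `f`. -/
noncomputable def ess {A B : Type*} {n : ℕ} (f : (Fin n → A) → B) : ℕ :=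
  (essSet f).ncard

/-- The identification minor of `f` in which the `i`-th variable is replaced by the `j`-th:
`(x₁, …, xₙ) ↦ f (x₁, …, xᵢ₋₁, xⱼ, xᵢ₊₁, …, xₙ)`. -/
def minor {A B : Type*} {n : ℕ} (f : (Fin n → A) → B) (i j : Fin n) : (Fin n → A) → B :=
  fun x => f (Function.update x i (x j))

/-- The arity gap of `f`: the minimum of `ess f - ess (minor f i j)` over all pairs `i ≠ j` of
essential variables of `f`. (For such `i`, `j` the essential variables of `minor f i j` are
essential in `f`, so the subtraction of natural numbers does not truncate; the minimum is a
genuine one as soon as `f` has two essential variables.) -/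
noncomputable def gap {A B : Type*} {n : ℕ} (f : (Fin n → A) → B) : ℕ :=
  sInf {k : ℕ | ∃ i ∈ essSet f, ∃ j ∈ essSet f, i ≠ j ∧ k = ess f - ess (minor f i j)}

/-- The sum `⨁_{i ∈ s} v i` of elements of `ℤ₃`, each identified with the corresponding
one-element set, in the Boolean group of all subsets of `ℤ₃` under symmetric difference. -/
def oplus {ι : Type*} (s : Finset ι) (v : ι → ZMod 3) : Finset (ZMod 3) :=
  s.fold (· ∆ ·) ∅ fun i => {v i}

/-- `⨁_{i < j} ((xᵢ - xⱼ)² p(xᵢ + xⱼ) + d)`. -/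
def pairSum {n : ℕ} (p : Polynomial (ZMod 3)) (d : ZMod 3) (x : Fin n → ZMod 3) :
    Finset (ZMod 3) :=
  oplus {q : Fin n × Fin n | q.1 < q.2} fun q =>
    (x q.1 - x q.2) ^ 2 * p.eval (x q.1 + x q.2) + d

/-- `⨁_i (p(xᵢ) + d)`. -/
def unarySum {n : ℕ} (p : Polynomial (ZMod 3)) (d : ZMod 3) (x : Fin n → ZMod 3) :
    Finset (ZMod 3) :=
  oplus Finset.univ fun i => p.eval (x i) + d

/-- The polynomial `p = a x² + b x + c` over `ℤ₃` (where `a = 0` is allowed) and the constant `d`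
represent `f`: the one-element set `{f x}` equals the expression belonging to the residue of `n`
modulo `4`, for all `x`. -/
def Represents {n : ℕ} (p : Polynomial (ZMod 3)) (d : ZMod 3)
    (f : (Fin n → ZMod 3) → ZMod 3) : Prop :=
  (∃ a b c : ZMod 3, p = .C a * .X ^ 2 + .C b * .X + .C c) ∧
  (n % 4 = 0 → ∀ x, {f x} = pairSum p d x ∆ {d}) ∧
  (n % 4 = 1 → ∀ x, {f x} = pairSum p d x ∆ unarySum p d x) ∧
  (n % 4 = 2 → ∀ x, {f x} = pairSum p d x) ∧
  (n % 4 = 3 → ∀ x, {f x} = pairSum p d x ∆ unarySum p d x ∆ {d})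

end ArityGap

/-! The link between the gap and the formulas is parity: for `n ≥ 4`, both sides say that `f x`
depends only on which elements of `ℤ₃` occur an odd number of times in `x`.

If the gap is not 1, every identification loses a second variable: either the merged one
(`PairFree`) or a further one (`FreeOn`). The core is `Collapses.pairFree`: the merged variable is
always lost. `Collapses.exists_second` shows that an identification keeping the merged variable
loses at least two others, so the hypothesis passes to any four places; there a merged variable that
survived would force `f` to ignore a variable on which it depends. Both arguments use the pigeonhole
principle for three values.

Once equal entries can be changed in pairs, `f` is symmetric (`swap_eq_of_pairFree`) and hence
determined by parities (`DeterminedByParity.of_pairFree`). Conversely, for such an `f` every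
identification loses exactly the two variables involved, so the gap is 2.

The three parities add up to `n` modulo 2, which leaves four patterns. A represented function takes
the values `p 0 + d`, `p 1 + d`, `p 2 + d`, `d` on them, so interpolation by a quadratic polynomial
gives existence and uniqueness of `p` and `d`. -/

namespace ArityGap

/-! ### Identifications that lose exactly one further variable: merged triples. -/

section Minors

variable {ι A B : Type*}

/-- Simultaneously changing two equal components `i`, `j` does not change the value of `f`. -/
def PairFree (f : (ι → A) → B) (i j : ι) : Prop :=
  ∀ x y, x i = x j → y i = y j → (∀ t, t ≠ i → t ≠ j → x t = y t) → f x = f y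

/-- On the tuples with equal components `i`, `j`, the function `f` does not depend on the
component `k`. -/
def FreeOn (f : (ι → A) → B) (i j k : ι) : Prop :=
  ∀ x y, x i = x j → y i = y j → (∀ t, t ≠ k → x t = y t) → f x = f y

/-- Every identification of two variables in `S` makes a further variable of `S` inessential. -/
def Collapses (f : (ι → A) → B) (S : Finset ι) : Prop :=
  ∀ i ∈ S, ∀ j ∈ S, i ≠ j → PairFree f i j ∨ ∃ k ∈ S, k ≠ i ∧ k ≠ j ∧ FreeOn f i j k

/-- `f` depends on the component `i`. -/
def DependsOn (f : (ι → A) → B) (i : ι) : Prop :=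
  ∃ x y, (∀ t, t ≠ i → x t = y t) ∧ f x ≠ f y

/-- The data attached to a merged triple: `h z x` is the value of `f` at the tuple obtained from
`x` by putting `z` at the places `i`, `j`, `k`; it depends on `z` and on every component in
`S \ {i, j, k}`. -/
structure Merged (f : (ι → A) → B) (S : Finset ι) (i j k : ι) (h : A → (ι → A) → B) : Prop where
  mem_i : i ∈ S
  mem_j : j ∈ S
  mem_k : k ∈ S
  hij : i ≠ j
  hik : i ≠ k
  hjk : j ≠ k
  congr : ∀ z x y, (∀ t, t ≠ i → t ≠ j → t ≠ k → x t = y t) → h z x = h z y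
  first : ∃ z z' x, h z x ≠ h z' x
  rest : ∀ l ∈ S, l ≠ i → l ≠ j → l ≠ k →
    ∃ z x y, (∀ t, t ≠ l → x t = y t) ∧ h z x ≠ h z y
  eq : ∀ x, x i = x j → f x = h (x i) x

theorem Merged.swap {f : (ι → A) → B} {S : Finset ι} {i j k : ι} {h : A → (ι → A) → B}
    (m : Merged f S i j k h) : Merged f S j i k h := by
  obtain ⟨mi, mj, mk, hij, hik, hjk, hc, h1, hr, he⟩ := m
  refine ⟨mj, mi, mk, hij.symm, hjk, hik, ?_, h1, ?_, ?_⟩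
  · exact fun z x y hxy => hc z x y fun t a b c => hxy t b a c
  · exact fun l ml a b c => hr l ml b a c
  · intro x hx
    rw [he x hx.symm, hx]

/-- The value of a merged triple cannot be read off a place outside the triple. -/
theorem Merged.not_const {f : (ι → A) → B} {S : Finset ι} {i j k : ι} {h : A → (ι → A) → B}
    (m : Merged f S i j k h) (l : ι) : ¬ ∀ z x, h z x = h (x l) x := by
  intro hh
  obtain ⟨z, z', x, hne⟩ := m.first
  exact hne ((hh z x).trans (hh z' x).symm)

variable [DecidableEq ι]

/-- If the pair `i`, `k` is free, both entries can be moved to `x j`; if `j` is lost, it can be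
moved to `x i`. No place outside the triple can be lost, since `h` still depends on it when the
triple is constant. -/
theorem Merged.pair {f : (ι → A) → B} {S : Finset ι} {i j k : ι} {h : A → (ι → A) → B}
    (m : Merged f S i j k h) (hS : Collapses f S) :
    (∀ x, x i = x k → f x = h (x j) x) ∨ (∀ x, x i = x k → f x = h (x i) x) := by
  obtain ⟨mi, mj, mk, hij, hik, hjk, hc, h1, hr, he⟩ := m
  rcases hS i mi k mk hik with hg | ⟨l, ml, hli, hlk, hp⟩
  · left
    intro x hx
    rw [hg x (Function.update (Function.update x i (x j)) k (x j)) hx (by grind) (by grind),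
      he _ (by grind), show (Function.update (Function.update x i (x j)) k (x j)) i = x j by grind]
    exact hc _ _ _ (by grind)
  · by_cases hlj : l = j
    · subst hlj
      right
      intro x hx
      rw [hp x (Function.update x l (x i)) hx (by grind) (by grind),
        he _ (by grind), show (Function.update x l (x i)) i = x i by grind]
      exact hc _ _ _ (by grind)
    · exfalso
      obtain ⟨z, x, y, hxy, hne⟩ := hr l ml hli hlj hlk
      apply hne
      have e1 := he (fun t => if t = i ∨ t = j ∨ t = k then z else x t) (by simp)
      have e2 := he (fun t => if t = i ∨ t = j ∨ t = k then z else y t) (by simp)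
      simp only [true_or, if_true] at e1 e2
      rw [hc z x (fun t => if t = i ∨ t = j ∨ t = k then z else x t) (by grind),
        hc z y (fun t => if t = i ∨ t = j ∨ t = k then z else y t) (by grind), ← e1, ← e2]
      exact hp _ _ (by simp) (by simp) (by grind)

/-- On tuples with `x i = x j` the entry at `k` is irrelevant, so it may be tied to the one at `l`
while `l` stays visible through `h`. This excludes a free pair `k`, `l`, and likewise the loss of
any place outside the triple; what is lost is `i` or `j`. -/
theorem Merged.pair_rest {f : (ι → A) → B} {S : Finset ι} {i j k : ι} {h : A → (ι → A) → B}
    (m : Merged f S i j k h) (hS : Collapses f S) {l : ι} (ml : l ∈ S) (hli : l ≠ i)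
    (hlj : l ≠ j) (hlk : l ≠ k) :
    (∀ x, x k = x l → f x = h (x i) x) ∨ (∀ x, x k = x l → f x = h (x j) x) := by
  obtain ⟨mi, mj, mk, hij, hik, hjk, hc, h1, hr, he⟩ := m
  rcases hS k mk l ml hlk.symm with hg | ⟨r, mr, hrk, hrl, hp⟩
  · exfalso
    obtain ⟨z, x, y, hxy, hne⟩ := hr l ml hli hlj hlk
    apply hne
    have e1 := he (fun t => if t = i ∨ t = j then z else if t = k then x l else x t) (by simp)
    have e2 := he (fun t => if t = i ∨ t = j then z else if t = k then y l else y t) (by simp)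
    simp only [true_or, if_true] at e1 e2
    rw [hc z x (fun t => if t = i ∨ t = j then z else if t = k then x l else x t) (by grind),
      hc z y (fun t => if t = i ∨ t = j then z else if t = k then y l else y t) (by grind),
      ← e1, ← e2]
    exact hg _ _ (by grind) (by grind) (by grind)
  · by_cases hrj : r = j
    · subst hrj
      left
      intro x hx
      rw [hp x (Function.update x r (x i)) hx (by grind) (by grind),
        he _ (by grind), show (Function.update x r (x i)) i = x i by grind]
      exact hc _ _ _ (by grind)
    by_cases hri : r = i
    · subst hri
      right
      intro x hx
      rw [hp x (Function.update x r (x j)) hx (by grind) (by grind),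
        he _ (by grind), show (Function.update x r (x j)) r = x j by grind]
      exact hc _ _ _ (by grind)
    exfalso
    obtain ⟨z, x, y, hxy, hne⟩ := hr r mr hri hrj hrk
    apply hne
    have e1 := he (fun t => if t = i ∨ t = j then z else if t = k then x l else x t) (by simp)
    have e2 := he (fun t => if t = i ∨ t = j then z else if t = k then y l else y t) (by simp)
    simp only [true_or, if_true] at e1 e2
    rw [hc z x (fun t => if t = i ∨ t = j then z else if t = k then x l else x t) (by grind),
      hc z y (fun t => if t = i ∨ t = j then z else if t = k then y l else y t) (by grind),
      ← e1, ← e2]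
    exact hp _ _ (by grind) (by grind) (by grind)

/-- Each wrong alternative of `Merged.pair` is tested on a tuple where three of the places `i`, `j`,
`k`, `l` carry `x l` and the remaining one of `i`, `j` carries `z`; it would give `h z x = h (x l)
x` for all `z`. -/
theorem Merged.pair_rest_left {f : (ι → A) → B} {S : Finset ι} {i j k : ι} {h : A → (ι → A) → B}
    (m : Merged f S i j k h) (hS : Collapses f S) {l : ι} (hli : l ≠ i)
    (hlj : l ≠ j) (hlk : l ≠ k) (hl : ∀ x, x k = x l → f x = h (x i) x) :
    (∀ x, x i = x k → f x = h (x i) x) ∧ (∀ x, x j = x k → f x = h (x i) x) := by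
  have hc := m.congr
  have hij := m.hij
  have hik := m.hik
  have hjk := m.hjk
  constructor
  · refine (m.pair hS).resolve_left fun hA => m.not_const l fun z x => ?_
    have e1 := hl (fun t => if t = i ∨ t = k then x l else if t = j then z else x t) (by grind)
    have e2 := hA (fun t => if t = i ∨ t = k then x l else if t = j then z else x t) (by grind)
    simp only [true_or, if_true, hij.symm, hjk, or_self, if_false] at e1 e2
    rw [hc _ x (fun t => if t = i ∨ t = k then x l else if t = j then z else x t) (by grind),
      ← e2, e1]
    exact hc _ _ _ (by grind)
  · refine (m.swap.pair hS).resolve_right fun hA => m.not_const l fun z x => ?_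
    have e1 := hl (fun t => if t = j ∨ t = k then x l else if t = i then z else x t) (by grind)
    have e2 := hA (fun t => if t = j ∨ t = k then x l else if t = i then z else x t) (by grind)
    simp only [true_or, if_true, hij, hik, or_self, if_false] at e1 e2
    rw [hc _ x (fun t => if t = j ∨ t = k then x l else if t = i then z else x t) (by grind),
      ← e1, e2]
    exact hc _ _ _ (by grind)

end Minors

/-! ### Three values: restricting the collapse property to fewer places. -/

section Ternary

variable {ι B : Type*} [DecidableEq ι]

/-- If `f` is given by a merged triple through its first place whenever the triple has a repeated
component, then `f` depends on neither of the other two places. -/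
theorem Merged.false_of_proj {f : (ι → ZMod 3) → B} {S : Finset ι} {i j k : ι}
    {h : ZMod 3 → (ι → ZMod 3) → B} (m : Merged f S i j k h) (hS : Collapses f S)
    (hd : DependsOn f j) {l : ι} (ml : l ∈ S) (hli : l ≠ i) (hlj : l ≠ j) (hlk : l ≠ k)
    (h1 : ∀ x, x i = x k → f x = h (x i) x) (h2 : ∀ x, x j = x k → f x = h (x i) x) : False := by
  have m' : Merged f S i k j h :=
    ⟨m.mem_i, m.mem_k, m.mem_j, m.hik, m.hij, m.hjk.symm,
      fun z x y hxy => m.congr z x y fun t a b c => hxy t a c b, m.first,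
      fun l ml a b c => m.rest l ml a c b, h1⟩
  have hc := m.congr
  have hij := m.hij
  have hik := m.hik
  have hjk := m.hjk
  have key : ∀ r ∈ S, r ≠ i → r ≠ j → r ≠ k →
      (∀ x, x k = x r → f x = h (x i) x) ∧ (∀ x, x j = x r → f x = h (x i) x) := by
    intro r mr hri hrj hrk
    constructor
    · refine (m.pair_rest hS mr hri hrj hrk).resolve_right fun hA => m.not_const r fun z x => ?_
      have := (m.swap.pair_rest_left hS hrj hri hrk hA).1
      have e1 := this (fun t => if t = j ∨ t = k then x r else if t = i then z else x t) (by grind)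
      have e2 := h2 (fun t => if t = j ∨ t = k then x r else if t = i then z else x t) (by grind)
      simp only [true_or, if_true, hij, hik, or_self, if_false] at e1 e2
      rw [hc _ x (fun t => if t = j ∨ t = k then x r else if t = i then z else x t) (by grind),
        ← e2, e1]
      exact hc _ _ _ (by grind)
    · refine (m'.pair_rest hS mr hri hrk hrj).resolve_right fun hA => m.not_const r fun z x => ?_
      have := (m'.swap.pair_rest_left hS hrk hri hrj hA).1
      have e1 := this (fun t => if t = j ∨ t = k then x r else if t = i then z else x t) (by grind)
      have e2 := h2 (fun t => if t = j ∨ t = k then x r else if t = i then z else x t) (by grind)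
      simp only [or_true, if_true, hij, hik, or_self, if_false] at e1 e2
      rw [hc _ x (fun t => if t = j ∨ t = k then x r else if t = i then z else x t) (by grind),
        ← e2, e1]
      exact hc _ _ _ (by grind)
  have all : ∀ x, f x = h (x i) x := by
    intro x
    by_cases hxij : x i = x j
    · exact m.eq x hxij
    by_cases hxik : x i = x k
    · exact h1 x hxik
    by_cases hxjk : x j = x k
    · exact h2 x hxjk
    by_cases hx : ∃ r ∈ S, r ≠ i ∧ r ≠ j ∧ r ≠ k ∧ (x k = x r ∨ x j = x r)
    · obtain ⟨r, mr, a, b, c, hx | hx⟩ := hx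
      · exact (key r mr a b c).1 x hx
      · exact (key r mr a b c).2 x hx
    -- What remains: three distinct entries at `i`, `j`, `k`, and every other entry in `S` differs
    -- from those at `j` and `k`, hence equals `x i`. So `x i = x l`, and the identification of `i`
    -- and `l` can be used to compare `f x` with its value after putting `x j` at `k`.
    push Not at hx
    have three : ∀ a b c d : ZMod 3, a = b ∨ a = c ∨ b = c ∨ c = d ∨ b = d ∨ d = a := by decide
    have hxr : ∀ r ∈ S, r ≠ i → r ≠ j → r ≠ k → x r = x i := fun r mr a b c =>
      (((((three _ _ _ _).resolve_left hxij).resolve_left hxik).resolve_left hxjk).resolve_left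
        (hx r mr a b c).1).resolve_left (hx r mr a b c).2
    have e' := h2 (Function.update x k (x j)) (by grind)
    have e'' : h (Function.update x k (x j) i) (Function.update x k (x j)) = h (x i) x := by
      rw [show Function.update x k (x j) i = x i by grind]
      exact hc _ _ _ (by grind)
    rw [e''] at e'
    rcases hS i m.mem_i l ml hli.symm with hg | ⟨r, mr, hri, hrl, hp⟩
    · rw [← e', hg x (Function.update (Function.update x i (x j)) l (x j)) (by grind) (by grind)
        (by grind), hg (Function.update x k (x j)) (Function.update (Function.update
        (Function.update x k (x j)) i (x j)) l (x j)) (by grind) (by grind) (by grind),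
        m.eq _ (by grind), m.eq _ (by grind)]
      rw [show Function.update (Function.update x i (x j)) l (x j) i = x j by grind,
        show Function.update (Function.update (Function.update x k (x j)) i (x j)) l (x j) i = x j
          by grind]
      exact hc _ _ _ (by grind)
    · have hil := hxr l ml hli hlj hlk
      by_cases hrk : r = k
      · rw [← e']
        exact hp _ _ (by grind) (by grind) (by grind)
      by_cases hrj : r = j
      · rw [hp x (Function.update x j (x k)) (by grind) (by grind) (by grind), h2 _ (by grind),
          show Function.update x j (x k) i = x i by grind]
        exact hc _ _ _ (by grind)
      rw [← e', hp x (Function.update x r (x j)) (by grind) (by grind) (by grind),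
        hp (Function.update x k (x j)) (Function.update (Function.update x k (x j)) r (x j))
          (by grind) (by grind) (by grind),
        (key r mr hri hrj hrk).2 _ (by grind), (key r mr hri hrj hrk).2 _ (by grind)]
      rw [show Function.update x r (x j) i = x i by grind,
        show Function.update (Function.update x k (x j)) r (x j) i = x i by grind]
      exact hc _ _ _ (by grind)
  obtain ⟨x, y, hxy, hne⟩ := hd
  rw [all x, all y, hxy i hij] at hne
  exact hne (hc _ _ _ fun t _ b _ => hxy t b)

/-- If identifying `i` and `j` keeps the merged variable essential, it loses no variable of `S` or
at least two of them. -/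
theorem Collapses.exists_second {f : (ι → ZMod 3) → B} {S : Finset ι} (hS : Collapses f S)
    (hd : ∀ i ∈ S, DependsOn f i) (hcard : 4 ≤ S.card) {i j k : ι} (mi : i ∈ S) (mj : j ∈ S)
    (mk : k ∈ S) (hij : i ≠ j) (hki : k ≠ i) (hkj : k ≠ j) (hng : ¬ PairFree f i j)
    (hp : FreeOn f i j k) :
    ∃ l ∈ S, l ≠ i ∧ l ≠ j ∧ l ≠ k ∧ FreeOn f i j l := by
  by_contra hcon
  push Not at hcon
  have ⟨l, ml, hl⟩ : ∃ l ∈ S, l ∉ ({i, j, k} : Finset ι) :=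
    Finset.exists_mem_notMem_of_card_lt_card (lt_of_le_of_lt Finset.card_le_three (by omega))
  simp only [Finset.mem_insert, Finset.mem_singleton, not_or] at hl
  obtain ⟨hli, hlj, hlk⟩ := hl
  let e : ZMod 3 → (ι → ZMod 3) → ι → ZMod 3 :=
    fun z x t => if t = i ∨ t = j ∨ t = k then z else x t
  have he : ∀ x, x i = x j → f x = f (e (x i) x) := by
    intro x hx
    exact hp _ _ hx (by simp [e]) (by grind)
  have m : Merged f S i j k fun z x => f (e z x) := by
    refine ⟨mi, mj, mk, hij, hki.symm, hkj.symm, ?_, ?_, ?_, he⟩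
    · intro z x y hxy
      exact congrArg f (by grind)
    · by_contra hh
      push Not at hh
      apply hng
      intro x y hx hy hxy
      rw [he x hx, he y hy, hh (x i) (y i) x]
      exact congrArg f (by grind)
    · intro r mr hri hrj hrk
      by_contra hh
      push Not at hh
      apply hcon r mr hri hrj hrk
      intro x y hx hy hxy
      rw [he x hx, he y hy, hxy i (by grind)]
      exact hh _ _ _ hxy
  rcases m.pair_rest hS ml hli hlj hlk with hA | hA
  · have := m.pair_rest_left hS hli hlj hlk hA
    exact m.false_of_proj hS (hd j mj) ml hli hlj hlk this.1 this.2
  · have := m.swap.pair_rest_left hS hlj hli hlk hA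
    exact m.swap.false_of_proj hS (hd i mi) ml hlj hli hlk this.1 this.2

/-- If the erased place is the lost variable, `Collapses.exists_second` provides another one to take
its role. -/
theorem Collapses.erase {f : (ι → ZMod 3) → B} {S : Finset ι} (hS : Collapses f S)
    (hd : ∀ i ∈ S, DependsOn f i) (hcard : 4 ≤ S.card) (r : ι) : Collapses f (S.erase r) := by
  intro i hi j hj hij
  rw [Finset.mem_erase] at hi hj
  by_cases hg : PairFree f i j
  · exact .inl hg
  obtain ⟨k, mk, hki, hkj, hp⟩ := (hS i hi.2 j hj.2 hij).resolve_left hg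
  by_cases hkr : k = r
  · obtain ⟨l, ml, a, b, c, hl⟩ := hS.exists_second hd hcard hi.2 hj.2 mk hij hki hkj hg hp
    exact .inr ⟨l, Finset.mem_erase.2 ⟨hkr ▸ c, ml⟩, a, b, hl⟩
  · exact .inr ⟨k, Finset.mem_erase.2 ⟨hkr, mk⟩, hki, hkj, hp⟩

theorem Collapses.subset {f : (ι → ZMod 3) → B} {S T : Finset ι} (hS : Collapses f S)
    (hd : ∀ i ∈ S, DependsOn f i) (hT : T ⊆ S) (hcard : 4 ≤ T.card) : Collapses f T := by
  induction S using Finset.strongInduction with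
  | H S ih =>
    by_cases h : T = S
    · exact h ▸ hS
    obtain ⟨r, hr, hrT⟩ := Finset.exists_of_ssubset (hT.ssubset_of_ne h)
    exact ih (S.erase r) (Finset.erase_ssubset hr)
      (hS.erase hd (hcard.trans (Finset.card_le_card hT)) r)
      (fun i hi => hd i (Finset.mem_of_mem_erase hi)) (Finset.subset_erase.2 ⟨hT, hrT⟩)

end Ternary

/-! ### Four places: the merged variable is always lost. -/

section FourPlaces

variable {ι B : Type*}

/-- Four places such that identifying two of them makes `f` independent either of the merged
variable or of both other places; `u z x` is the value of `f` at the tuple obtained from `x` by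
putting `z` at all four places. -/
structure Quadruple (f : (ι → ZMod 3) → B) (p q r s : ι) (u : ZMod 3 → (ι → ZMod 3) → B) :
    Prop where
  hpq : p ≠ q
  hpr : p ≠ r
  hps : p ≠ s
  hqr : q ≠ r
  hqs : q ≠ s
  hrs : r ≠ s
  congr : ∀ z x y, (∀ t, t ≠ p → t ≠ q → t ≠ r → t ≠ s → x t = y t) → u z x = u z y
  dich : ∀ i j, i ≠ j → (i = p ∨ i = q ∨ i = r ∨ i = s) → (j = p ∨ j = q ∨ j = r ∨ j = s) →
    PairFree f i j ∨ ∀ x, x i = x j → f x = u (x i) x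
  first : ∃ z z' x, u z x ≠ u z' x

variable {f : (ι → ZMod 3) → B} {p q r s : ι} {u : ZMod 3 → (ι → ZMod 3) → B}

theorem Quadruple.perm_pq (m : Quadruple f p q r s u) : Quadruple f q p s r u := by
  obtain ⟨a, b, c, d, e, g, hc, hd, h1⟩ := m
  refine ⟨a.symm, e, d, c, b, g.symm, fun z x y hxy => hc z x y (by grind), ?_, h1⟩
  intro i j hij hi hj
  exact hd i j hij (by grind) (by grind)

theorem Quadruple.perm_rs (m : Quadruple f p q r s u) : Quadruple f p q s r u := by
  obtain ⟨a, b, c, d, e, g, hc, hd, h1⟩ := m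
  refine ⟨a, c, b, e, d, g.symm, fun z x y hxy => hc z x y (by grind), ?_, h1⟩
  intro i j hij hi hj
  exact hd i j hij (by grind) (by grind)

theorem Quadruple.perm_qr (m : Quadruple f p q r s u) : Quadruple f p r q s u := by
  obtain ⟨a, b, c, d, e, g, hc, hd, h1⟩ := m
  refine ⟨b, a, c, d.symm, g, e, fun z x y hxy => hc z x y (by grind), ?_, h1⟩
  intro i j hij hi hj
  exact hd i j hij (by grind) (by grind)

theorem Quadruple.not_swap (m : Quadruple f p q r s u) : ¬ ∀ z w x, u z x = u w x := by
  intro hh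
  obtain ⟨z, z', x, hne⟩ := m.first
  exact hne (hh z z' x)

variable [DecidableEq ι]

theorem Quadruple.eq_right (m : Quadruple f p q r s u) (h : ∀ x, x p = x q → f x = u (x p) x)
    (hg : PairFree f p r) (x : ι → ZMod 3) (hx : x p = x r) : f x = u (x q) x := by
  have := m.hpq
  have := m.hpr
  have := m.hqr
  rw [hg x (Function.update (Function.update x p (x q)) r (x q)) hx (by grind) (by grind),
    h _ (by grind), show Function.update (Function.update x p (x q)) r (x q) p = x q by grind]
  exact m.congr _ _ _ (by grind)

/-- Otherwise the pattern `z, z, w, w` on `p, q, r, s` has both values `u z` and `u w`. -/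
theorem Quadruple.pairFree_opposite (m : Quadruple f p q r s u)
    (h : ∀ x, x p = x q → f x = u (x p) x) : PairFree f r s := by
  refine (m.dich r s m.hrs (by simp) (by simp)).resolve_right fun hA => m.not_swap fun z w x => ?_
  obtain ⟨a, b, c, d, e, g, hc, hd, h1⟩ := m
  have e1 := h (fun t => if t = p ∨ t = q then z else if t = r ∨ t = s then w else x t) (by grind)
  have e2 := hA (fun t => if t = p ∨ t = q then z else if t = r ∨ t = s then w else x t) (by grind)
  simp only [true_or, if_true, b.symm, d.symm, or_self, if_false] at e1 e2
  rw [hc z x (fun t => if t = p ∨ t = q then z else if t = r ∨ t = s then w else x t) (by grind),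
    ← e1, e2]
  exact hc _ _ _ (by grind)

/-- The pattern with `z` on `p, r` and `w` on `q, s` can be evaluated through either free pair,
giving `u w` and `u z`. -/
theorem Quadruple.not_both (m : Quadruple f p q r s u) (h : ∀ x, x p = x q → f x = u (x p) x)
    (hpr : PairFree f p r) (hqs : PairFree f q s) : False := by
  refine m.not_swap fun z w x => ?_
  have h1 := m.eq_right h hpr
  have h2 := m.perm_pq.eq_right (fun x hx => by rw [h x hx.symm, hx]) hqs
  obtain ⟨a, b, c, d, e, g, hc, hd, -⟩ := m
  have e1 := h1 (fun t => if t = p ∨ t = r then z else if t = q ∨ t = s then w else x t) (by grind)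
  have e2 := h2 (fun t => if t = p ∨ t = r then z else if t = q ∨ t = s then w else x t) (by grind)
  simp only [true_or, if_true, a.symm, d, or_self, if_false] at e1 e2
  rw [hc z x (fun t => if t = p ∨ t = r then z else if t = q ∨ t = s then w else x t) (by grind),
    ← e2, e1]
  exact hc _ _ _ (by grind)

/-- The pairs among `q, r, s` turn out to be free, and all pairs containing `p` give `u (x p)`. Four
entries from three values must repeat, so `f x = u (x p) x` everywhere, contrary to the dependence
on `q`. -/
theorem Quadruple.false_of_adjacent (m : Quadruple f p q r s u)
    (h : ∀ x, x p = x q → f x = u (x p) x) (h' : ∀ x, x p = x r → f x = u (x p) x)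
    (hdq : DependsOn f q) : False := by
  have grs := m.pairFree_opposite h
  have gqs := m.perm_qr.pairFree_opposite h'
  have gqr : PairFree f q r := by
    refine (m.dich q r m.hqr (by simp) (by simp)).resolve_right fun hA =>
      m.not_swap fun z w x => ?_
    have h2 := m.perm_pq.eq_right (fun x hx => by rw [h x hx.symm, hx]) gqs
    obtain ⟨a, b, c, d, e, g, hc, hd, -⟩ := m
    have e1 := h2 (fun t => if t = p then z else if t = q ∨ t = r ∨ t = s then w else x t)
      (by grind)
    have e2 := hA (fun t => if t = p then z else if t = q ∨ t = r ∨ t = s then w else x t)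
      (by grind)
    simp only [true_or, if_true, a.symm, if_false] at e1 e2
    rw [hc z x (fun t => if t = p then z else if t = q ∨ t = r ∨ t = s then w else x t)
      (by grind), ← e1, e2]
    exact hc _ _ _ (by grind)
  have hps : ∀ x, x p = x s → f x = u (x p) x :=
    (m.dich p s m.hps (by simp) (by simp)).resolve_left fun hg =>
      m.perm_rs.not_both h hg gqr
  have all : ∀ x, f x = u (x p) x := by
    intro x
    obtain ⟨a, b, c, d, e, g, hc, hd, -⟩ := m
    have three : ∀ a b c d : ZMod 3, a = b ∨ a = c ∨ a = d ∨ b = c ∨ b = d ∨ c = d := by decide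
    have aux : ∀ k l, k ≠ p → l ≠ p → (k = q ∨ k = r ∨ k = s) → (l = q ∨ l = r ∨ l = s) →
        PairFree f k l → x k = x l → (∀ x, x p = x k → f x = u (x p) x) → f x = u (x p) x := by
      intro k l hk hl hk' hl' hg hx hh
      rw [hg x (Function.update (Function.update x k (x p)) l (x p)) hx (by grind) (by grind),
        hh _ (by grind), show Function.update (Function.update x k (x p)) l (x p) p = x p by grind]
      exact hc _ _ _ (by grind)
    rcases three (x p) (x q) (x r) (x s) with hx | hx | hx | hx | hx | hx
    · exact h x hx
    · exact h' x hx
    · exact hps x hx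
    · exact aux q r a.symm b.symm (by simp) (by simp) gqr hx h
    · exact aux q s a.symm c.symm (by simp) (by simp) gqs hx h
    · exact aux r s b.symm c.symm (by simp) (by simp) grs hx h'
  obtain ⟨x, y, hxy, hne⟩ := hdq
  rw [all x, all y, hxy p m.hpq] at hne
  exact hne (m.congr _ _ _ fun t _ b _ _ => hxy t b)

/-- By `Quadruple.not_both`, one of the pairs `p, r` and `q, s` is not free; it meets `p, q` in a
single place. -/
theorem Quadruple.false_of_eq (m : Quadruple f p q r s u)
    (h : ∀ x, x p = x q → f x = u (x p) x) (hdp : DependsOn f p) (hdq : DependsOn f q) :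
    False := by
  rcases m.dich p r m.hpr (by simp) (by simp) with hg | hA
  · rcases m.dich q s m.hqs (by simp) (by simp) with hg' | hA
    · exact m.not_both h hg hg'
    · exact m.perm_pq.false_of_adjacent (fun x hx => by rw [h x hx.symm, hx]) hA hdp
  · exact m.false_of_adjacent h hA hdq

/-- With only four places, losing two besides the merged pair means losing all the others; this is
the alternative in `Quadruple`. -/
theorem Collapses.pairFree_of_card_eq_four {S : Finset ι} (hS : Collapses f S)
    (hd : ∀ i ∈ S, DependsOn f i) (hcard : S.card = 4) {p q : ι} (mp : p ∈ S) (mq : q ∈ S)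
    (hpq : p ≠ q) : PairFree f p q := by
  by_contra hng
  have hc2 : ((S.erase p).erase q).card = 2 := by
    rw [Finset.card_erase_of_mem (Finset.mem_erase.2 ⟨hpq.symm, mq⟩), Finset.card_erase_of_mem mp,
      hcard]
  obtain ⟨r, s, hrs, hrs'⟩ := Finset.card_eq_two.1 hc2
  have hmem : ∀ t, t ∈ S ↔ t = p ∨ t = q ∨ t = r ∨ t = s := by
    intro t
    have := Finset.ext_iff.1 hrs' t
    simp only [Finset.mem_erase, Finset.mem_insert, Finset.mem_singleton] at this
    grind
  have hne : r ≠ p ∧ r ≠ q ∧ s ≠ p ∧ s ≠ q := by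
    have h1 := Finset.ext_iff.1 hrs' r
    have h2 := Finset.ext_iff.1 hrs' s
    simp only [Finset.mem_erase, Finset.mem_insert, Finset.mem_singleton] at h1 h2
    grind
  let e : ZMod 3 → (ι → ZMod 3) → ι → ZMod 3 := fun z x t => if t ∈ S then z else x t
  have dich : ∀ i ∈ S, ∀ j ∈ S, i ≠ j →
      PairFree f i j ∨ ∀ x, x i = x j → f x = f (e (x i) x) := by
    intro i hi j hj hij
    by_cases hg : PairFree f i j
    · exact .inl hg
    right
    obtain ⟨k, mk, hki, hkj, hk⟩ := (hS i hi j hj hij).resolve_left hg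
    obtain ⟨l, ml, hli, hlj, hlk, hl⟩ :=
      hS.exists_second hd hcard.ge hi hj mk hij hki hkj hg hk
    have hall : ({i, j, k, l} : Finset ι) = S := by
      apply Finset.eq_of_subset_of_card_le
      · grind
      · rw [hcard, Finset.card_insert_of_notMem (by grind), Finset.card_insert_of_notMem (by grind),
          Finset.card_insert_of_notMem (by grind), Finset.card_singleton]
    intro x hx
    have hall' : ∀ t, t ∈ S ↔ t = i ∨ t = j ∨ t = k ∨ t = l := by
      intro t
      rw [← hall]
      simp
    rw [hk x (Function.update x k (x i)) hx (by grind) (by grind)]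
    exact hl _ _ (by grind) (by grind) (by grind)
  have m : Quadruple f p q r s fun z x => f (e z x) := by
    refine ⟨hpq, hne.1.symm, hne.2.2.1.symm, hne.2.1.symm, hne.2.2.2.symm, hrs, ?_, ?_, ?_⟩
    · intro z x y hxy
      exact congrArg f (by grind)
    · intro i j hij hi hj
      exact dich i ((hmem i).2 hi) j ((hmem j).2 hj) hij
    · by_contra hh
      push Not at hh
      apply hng
      intro x y hx hy hxy
      have hA := (dich p mp q mq hpq).resolve_left hng
      rw [hA x hx, hA y hy, hh (x p) (y p) x]
      exact congrArg f (by grind)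
  exact m.false_of_eq ((dich p mp q mq hpq).resolve_left hng) (hd p mp) (hd q mq)

theorem Collapses.pairFree {S : Finset ι} (hS : Collapses f S) (hd : ∀ i ∈ S, DependsOn f i)
    (hcard : 4 ≤ S.card) {p q : ι} (mp : p ∈ S) (mq : q ∈ S) (hpq : p ≠ q) : PairFree f p q := by
  obtain ⟨T, hT, hTS, hT4⟩ := Finset.exists_subsuperset_card_eq (n := 4)
    (show ({p, q} : Finset ι) ⊆ S by grind) (by rw [Finset.card_pair hpq]; omega) hcard
  exact (hS.subset hd hTS hT4.ge).pairFree_of_card_eq_four (fun i hi => hd i (hTS hi)) hT4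
    (hT (by simp)) (hT (by simp)) hpq

end FourPlaces

/-! ### Free pairs make `f` symmetric. -/

section Swap

variable {ι A B : Type*} [DecidableEq ι]

/-- Two pair moves effect the transposition: `i, k` take the value `x j`, and then `j, k` take the
old value `x i`. -/
theorem swap_eq_of_third {f : (ι → A) → B} (hg : ∀ i j, i ≠ j → PairFree f i j) {i j k : ι}
    (hki : k ≠ i) (hkj : k ≠ j) (hij : i ≠ j) (x : ι → A) (hx : x k = x i) :
    f (x ∘ Equiv.swap i j) = f x := by
  rw [hg i k hki.symm x (Function.update (Function.update x i (x j)) k (x j)) hx.symm (by grind)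
    (by grind)]
  apply hg j k hkj.symm
  · simp [Equiv.swap_apply_of_ne_of_ne hki hkj, hx]
  · grind
  · intro t h1 h2
    by_cases hti : t = i
    · subst hti
      simp [hki.symm]
    · simp [Equiv.swap_apply_of_ne_of_ne hti h1, hti, h2]

theorem swap_eq_of_pairFree [Fintype ι] {f : (ι → ZMod 3) → B}
    (hg : ∀ i j, i ≠ j → PairFree f i j) (hcard : 4 ≤ Fintype.card ι) (i j : ι)
    (x : ι → ZMod 3) : f (x ∘ Equiv.swap i j) = f x := by
  by_cases hij : i = j
  · simp [hij]
  by_cases hx : x i = x j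
  · congr 1
    ext t
    simp only [Function.comp, Equiv.swap_apply_def]
    split_ifs <;> simp_all
  by_cases hA : ∃ k, k ≠ i ∧ k ≠ j ∧ x k = x i
  · obtain ⟨k, hki, hkj, hk⟩ := hA
    exact swap_eq_of_third hg hki hkj hij x hk
  by_cases hA' : ∃ k, k ≠ i ∧ k ≠ j ∧ x k = x j
  · obtain ⟨k, hki, hkj, hk⟩ := hA'
    rw [Equiv.swap_comm]
    exact swap_eq_of_third hg hkj hki (Ne.symm hij) x hk
  push Not at hA hA'
  have h2 : 1 < (Finset.univ \ {i, j} : Finset ι).card := by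
    rw [Finset.card_sdiff_of_subset (Finset.subset_univ _), Finset.card_univ, Finset.card_pair hij]
    omega
  obtain ⟨k, hk, l, hl, hkl⟩ := Finset.one_lt_card.1 h2
  simp only [Finset.mem_sdiff, Finset.mem_univ, true_and, Finset.mem_insert,
    Finset.mem_singleton, not_or] at hk hl
  have three : ∀ a b c d : ZMod 3, a = b ∨ c = a ∨ c = b ∨ d = a ∨ d = b ∨ c = d := by decide
  have hxkl : x k = x l := by
    have := three (x i) (x j) (x k) (x l)
    have := hA k hk.1 hk.2
    have := hA' k hk.1 hk.2
    have := hA l hl.1 hl.2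
    have := hA' l hl.1 hl.2
    tauto
  -- All places other than `i`, `j` carry the third value. Two of them are moved together to `x i`,
  -- the transposition is made with their help, and they are moved back.
  have e := swap_eq_of_third hg hk.1 hk.2 hij
    (Function.update (Function.update x k (x i)) l (x i)) (by grind)
  rw [hg k l hkl x (Function.update (Function.update x k (x i)) l (x i)) hxkl (by grind)
    (by grind), ← e]
  apply hg k l hkl
  · simpa [Equiv.swap_apply_of_ne_of_ne hk.1 hk.2, Equiv.swap_apply_of_ne_of_ne hl.1 hl.2]
  · simp [Equiv.swap_apply_of_ne_of_ne hk.1 hk.2, Equiv.swap_apply_of_ne_of_ne hl.1 hl.2, hkl]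
  · intro t h1 h3
    simp only [Function.comp, Equiv.swap_apply_def]
    grind

end Swap

/-! ### Symmetry and free pairs mean dependence on parities only. -/

section Parity

variable {ι A B : Type*} [Fintype ι] [DecidableEq A]

/-- The parity of the number of occurrences of `c` in the tuple `x`. -/
def par (x : ι → A) (c : A) : ZMod 2 :=
  ∑ i, if x i = c then 1 else 0

theorem par_comp (x : ι → A) (σ : Equiv.Perm ι) (c : A) : par (x ∘ σ) c = par x c :=
  Equiv.sum_comp σ fun i => if x i = c then (1 : ZMod 2) else 0

variable [DecidableEq ι]

theorem par_update (x : ι → A) (i : ι) (a c : A) :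
    par (Function.update x i a) c =
      par x c + (if x i = c then 1 else 0) + if a = c then 1 else 0 := by
  unfold par
  rw [← Finset.add_sum_erase _ _ (Finset.mem_univ i),
    ← Finset.add_sum_erase _ (fun t => if x t = c then (1 : ZMod 2) else 0) (Finset.mem_univ i),
    Finset.sum_congr rfl (g := fun t => if x t = c then (1 : ZMod 2) else 0)]
  · simp only [Function.update_self]
    generalize (∑ t ∈ Finset.univ.erase i, if x t = c then (1 : ZMod 2) else 0) = S
    split_ifs <;> revert S <;> decide
  · intro t ht
    rw [Function.update_of_ne (Finset.ne_of_mem_erase ht)]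

theorem par_pair (x : ι → A) {i j : ι} (hij : i ≠ j) (hx : x i = x j) (a c : A) :
    par (Function.update (Function.update x i a) j a) c = par x c := by
  rw [par_update, par_update, Function.update_of_ne hij.symm, hx]
  generalize par x c = S
  split_ifs <;> revert S <;> decide

/-- The value of `f` is determined by the set of elements that occur an odd number of times. -/
def DeterminedByParity (f : (ι → A) → B) : Prop :=
  ∀ x y, (∀ c, par x c = par y c) → f x = f y

/-- Induction on the number of places where `x` and `y` differ: a transposition or a pair move makes
one more place agree and spoils none. -/
theorem DeterminedByParity.of_pairFree {f : (ι → A) → B}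
    (hg : ∀ i j, i ≠ j → PairFree f i j)
    (hs : ∀ i j x, f (x ∘ Equiv.swap i j) = f x) : DeterminedByParity f := by
  have key : ∀ (n : ℕ) (x y : ι → A), (∀ c, par x c = par y c) →
      (Finset.univ.filter fun t => x t ≠ y t).card = n → f x = f y := by
    intro n
    induction n using Nat.strong_induction_on with
    | _ n ih =>
    intro x y hxy hn
    have step : ∀ x' : ι → A, f x' = f x → (∀ c, par x' c = par x c) →
        (∀ t, x' t ≠ y t → x t ≠ y t) → (∃ t, x t ≠ y t ∧ x' t = y t) → f x = f y := by
      intro x' hf hp hsub ⟨t, ht, ht'⟩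
      rw [← hf]
      refine ih _ ?_ x' y (fun c => (hp c).trans (hxy c)) rfl
      rw [← hn]
      apply Finset.card_lt_card
      refine ⟨fun t ht => ?_, fun h => ?_⟩
      · simp only [Finset.mem_filter, Finset.mem_univ, true_and] at ht ⊢
        exact hsub t ht
      · have := h (show t ∈ _ by simpa using ht)
        simp [ht'] at this
    by_cases hD : ∃ i, x i ≠ y i
    swap
    · push Not at hD
      rw [funext hD]
    obtain ⟨i, hi⟩ := hD
    by_cases hA : ∃ k l, x k ≠ y k ∧ x l ≠ y l ∧ x k = y l
    · obtain ⟨k, l, hk, hl, hkl⟩ := hA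
      refine step (x ∘ Equiv.swap k l) (hs k l x) (par_comp x _) ?_ ⟨l, hl, by simpa using hkl⟩
      intro t ht htt
      simp only [Function.comp, Equiv.swap_apply_def] at ht
      split_ifs at ht with h1 h2
      · exact hk (h1 ▸ htt)
      · exact hl (h2 ▸ htt)
      · exact ht htt
    push Not at hA
    -- Here `y` never takes the value `x i` at a place of disagreement, so equal parities force `x`
    -- to take it at a second such place.
    obtain ⟨j, hji, hj, hij⟩ : ∃ j, j ≠ i ∧ x j ≠ y j ∧ x j = x i := by
      by_contra hcon
      push Not at hcon
      have h1 : ∑ t, ((if x t = x i then (1 : ZMod 2) else 0) + if y t = x i then 1 else 0) = 1 := by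
        rw [Finset.sum_eq_single i]
        · simp [Ne.symm hi]
        · intro t _ hti
          by_cases htt : x t = y t
          · rw [htt]
            split_ifs <;> decide
          · rw [if_neg (hcon t hti htt), if_neg fun h => hA i t hi htt h.symm]
            rfl
        · simp
      rw [Finset.sum_add_distrib] at h1
      have h2 := hxy (x i)
      unfold par at h2
      rw [h2] at h1
      generalize (∑ t, if y t = x i then (1 : ZMod 2) else 0) = S at h1
      revert S
      decide
    refine step (Function.update (Function.update x i (y i)) j (y i)) ?_ ?_ ?_ ⟨i, hi, ?_⟩
    · exact hg i j hji.symm _ _ (by grind) hij.symm (by grind)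
    · exact fun c => par_pair x hji.symm hij.symm _ c
    · intro t ht
      grind
    · grind
  exact fun x y hxy => key _ x y hxy rfl

theorem DeterminedByParity.pairFree {f : (ι → A) → B} (hf : DeterminedByParity f) {i j : ι}
    (hij : i ≠ j) : PairFree f i j := by
  intro x y hx hy hxy
  apply hf
  intro c
  rw [← par_pair x hij hx (y i) c]
  congr 1
  grind

end Parity

/-! ### Tuples with at most two nonzero entries realize all parity patterns. -/

section Reference

variable {ι : Type*} [Fintype ι]

theorem par_add_add (x : ι → ZMod 3) : par x 0 + par x 1 + par x 2 = Fintype.card ι := by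
  unfold par
  rw [← Finset.sum_add_distrib, ← Finset.sum_add_distrib, Finset.sum_congr rfl (g := fun _ => 1)]
  · simp
  · intro i _
    generalize x i = a
    revert a
    decide

variable [DecidableEq ι]

/-- The tuple with the entries `a`, `b` at the places `r`, `s`, and zeros elsewhere. -/
def twoEntries (r s : ι) (a b : ZMod 3) : ι → ZMod 3 :=
  Function.update (Function.update 0 r a) s b

theorem par_twoEntries {r s : ι} (hrs : r ≠ s) (a b c : ZMod 3) :
    par (twoEntries r s a b) c = (if c = 0 then (Fintype.card ι : ZMod 2) else 0) +
      (if a = c then 1 else 0) + if b = c then 1 else 0 := by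
  rw [twoEntries, par_update, par_update, Function.update_of_ne hrs.symm]
  have : par (0 : ι → ZMod 3) c = if c = 0 then (Fintype.card ι : ZMod 2) else 0 := by
    unfold par
    by_cases hc : c = 0
    · simp [hc]
    · simp [hc, Ne.symm hc]
  rw [this]
  simp only [Pi.zero_apply]
  generalize (if c = 0 then (Fintype.card ι : ZMod 2) else 0) = S
  split_ifs <;> revert S <;> decide

theorem exists_par_eq_twoEntries {r s : ι} (hrs : r ≠ s) (x : ι → ZMod 3) :
    ∃ a b, ∀ c, par x c = par (twoEntries r s a b) c := by
  have key : ∀ u v w : ZMod 2, ∃ a b : ZMod 3,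
      (u = (u + v + w) + (if a = 0 then 1 else 0) + if b = 0 then 1 else 0) ∧
      (v = 0 + (if a = 1 then 1 else 0) + if b = 1 then 1 else 0) ∧
      (w = 0 + (if a = 2 then 1 else 0) + if b = 2 then 1 else 0) := by decide
  obtain ⟨a, b, h0, h1, h2⟩ := key (par x 0) (par x 1) (par x 2)
  rw [par_add_add] at h0
  refine ⟨a, b, fun c => ?_⟩
  rw [par_twoEntries hrs]
  fin_cases c
  · exact h0
  · exact h1
  · exact h2

/-- Tuples supported on `r` and a fourth place `s` vanish at `i` and `j`, so the entry at `r` can be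
erased. Parity lets the other entry migrate from `s` to `r`, where it is erased too. -/
theorem DeterminedByParity.const_of_freeOn {B : Type*} {f : (ι → ZMod 3) → B}
    (hf : DeterminedByParity f) (hcard : 4 ≤ Fintype.card ι) {i j r : ι}
    (hri : r ≠ i) (hrj : r ≠ j) (hp : FreeOn f i j r) (x y : ι → ZMod 3) : f x = f y := by
  obtain ⟨s, -, hs⟩ : ∃ s ∈ Finset.univ, s ∉ ({i, j, r} : Finset ι) :=
    Finset.exists_mem_notMem_of_card_lt_card
      (lt_of_le_of_lt Finset.card_le_three (by rw [Finset.card_univ]; omega))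
  simp only [Finset.mem_insert, Finset.mem_singleton, not_or] at hs
  obtain ⟨hsi, hsj, hsr⟩ := hs
  have drop : ∀ a b, f (twoEntries r s a b) = f (twoEntries r s 0 b) := by
    intro a b
    apply hp
    · simp [twoEntries, Ne.symm hri, Ne.symm hrj, Ne.symm hsi, Ne.symm hsj]
    · simp [twoEntries, Ne.symm hsi, Ne.symm hsj]
    · intro t ht
      by_cases hts : t = s
      · simp [twoEntries, hts]
      · simp [twoEntries, ht, hts]
  have zero : ∀ x, f x = f (twoEntries r s 0 0) := by
    intro x
    obtain ⟨a, b, h⟩ := exists_par_eq_twoEntries (Ne.symm hsr) x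
    rw [hf _ _ h, drop, hf _ (twoEntries r s b 0), drop]
    intro c
    rw [par_twoEntries (Ne.symm hsr), par_twoEntries (Ne.symm hsr)]
    ring
  rw [zero x, zero y]

end Reference

/-! ### The gap in terms of free pairs and lost variables. -/

section Gap

variable {A B : Type*} {n : ℕ} {f : (Fin n → A) → B}

theorem IsEssential.dependsOn {i : Fin n} (h : IsEssential f i) : DependsOn f i := by
  obtain ⟨x, a, h⟩ := h
  exact ⟨x, _, fun t ht => (Function.update_of_ne ht _ _).symm, h⟩

theorem minor_eq {i j : Fin n} {x : Fin n → A} (hx : x i = x j) : minor f i j x = f x := by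
  rw [minor, ← hx, Function.update_eq_self]

theorem not_isEssential_minor_left {i j : Fin n} (hij : i ≠ j) : ¬ IsEssential (minor f i j) i := by
  rintro ⟨x, a, h⟩
  simp [minor, hij.symm] at h

theorem freeOn_of_not_isEssential {i j r : Fin n} (h : ¬ IsEssential (minor f i j) r) :
    FreeOn f i j r := by
  intro x y hx hy hxy
  simp only [IsEssential, not_exists, not_not] at h
  rw [← minor_eq (f := f) hx, ← minor_eq (f := f) hy, h x (y r)]
  congr 1
  ext t
  by_cases ht : t = r
  · simp [ht]
  · simp [ht, hxy t ht]

theorem pairFree_iff_not_isEssential {i j : Fin n} (hij : i ≠ j) :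
    PairFree f i j ↔ ¬ IsEssential (minor f i j) j := by
  constructor
  · rintro h ⟨x, a, hne⟩
    apply hne
    unfold minor
    apply h
    · simp [hij.symm]
    · simp [hij.symm]
    · intro t h1 h2
      simp [h1, h2]
  · intro h x y hx hy hxy
    simp only [IsEssential, not_exists, not_not] at h
    rw [← minor_eq (f := f) hx, h x (y j), minor]
    congr 1
    ext t
    by_cases hti : t = i
    · simp [hti, hy]
    by_cases htj : t = j
    · subst htj
      simp [hti]
    · simp [hti, htj, hxy t hti htj]

theorem ess_eq_of_forall (hf : ∀ i, IsEssential f i) : ess f = n := by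
  have : essSet f = Set.univ := Set.eq_univ_of_forall hf
  rw [ess, this, Set.ncard_univ, Nat.card_fin]

theorem exists_gap_eq (hn : 2 ≤ n) (hf : ∀ i, IsEssential f i) :
    ∃ i j, i ≠ j ∧ gap f = n - ess (minor f i j) := by
  have hne : {k : ℕ | ∃ i ∈ essSet f, ∃ j ∈ essSet f, i ≠ j ∧
      k = ess f - ess (minor f i j)}.Nonempty :=
    ⟨_, ⟨0, by omega⟩, hf _, ⟨1, by omega⟩, hf _, by simp, rfl⟩
  obtain ⟨i, -, j, -, hij, h⟩ := Nat.sInf_mem hne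
  exact ⟨i, j, hij, by rw [gap, h, ess_eq_of_forall hf]⟩

theorem gap_le (hf : ∀ i, IsEssential f i) {i j : Fin n} (hij : i ≠ j) :
    gap f ≤ n - ess (minor f i j) :=
  Nat.sInf_le ⟨i, hf i, j, hf j, hij, by rw [ess_eq_of_forall hf]⟩

theorem ess_eq_sub_of_essSet {g : (Fin n → A) → B} (s : Finset (Fin n))
    (h : essSet g = (s : Set (Fin n))ᶜ) : ess g = n - s.card := by
  rw [ess, h, ← Finset.coe_compl, Set.ncard_coe_finset, Finset.card_compl, Fintype.card_fin]

theorem ess_minor_le {i j : Fin n} (hij : i ≠ j) : ess (minor f i j) ≤ n - 1 := by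
  have h : essSet (minor f i j) ⊆ (({i}ᶜ : Finset (Fin n)) : Set (Fin n)) := by
    intro t ht
    simp only [Finset.coe_compl, Finset.coe_singleton, Set.mem_compl_iff, Set.mem_singleton_iff]
    rintro rfl
    exact not_isEssential_minor_left hij ht
  have := Set.ncard_le_ncard h
  rwa [Set.ncard_coe_finset, Finset.card_compl, Fintype.card_fin, Finset.card_singleton] at this

/-- A pair violating the property keeps `n - 1` essential variables, the most any minor can have,
which makes the gap 1. -/
theorem collapses_of_gap_ne_one (hn : 2 ≤ n) (hf : ∀ i, IsEssential f i) (hg : gap f ≠ 1) :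
    Collapses f Finset.univ := by
  intro i _ j _ hij
  by_contra hcon
  push Not at hcon
  obtain ⟨h1, h2⟩ := hcon
  have he : ess (minor f i j) = n - 1 := by
    rw [ess_eq_sub_of_essSet {i}, Finset.card_singleton]
    ext t
    simp only [Finset.coe_singleton, Set.mem_compl_iff, Set.mem_singleton_iff]
    constructor
    · rintro ht rfl
      exact not_isEssential_minor_left hij ht
    · intro hti
      by_contra hess
      by_cases htj : t = j
      · subst htj
        exact h1 ((pairFree_iff_not_isEssential hij).2 hess)
      · exact h2 t (Finset.mem_univ t) hti htj (freeOn_of_not_isEssential hess)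
  obtain ⟨k, l, hkl, h⟩ := exists_gap_eq hn hf
  have := ess_minor_le (f := f) hkl
  have := gap_le hf hij
  omega

end Gap

/-! ### Gap different from 1, parity, and gap 2. -/

section GapTernary

variable {B : Type*} {n : ℕ} {f : (Fin n → ZMod 3) → B}

theorem determinedByParity_of_gap_ne_one (hn : 4 ≤ n) (hf : ∀ i, IsEssential f i)
    (hg : gap f ≠ 1) : DeterminedByParity f := by
  have hp : ∀ i j, i ≠ j → PairFree f i j := fun i j hij =>
    (collapses_of_gap_ne_one (by omega) hf hg).pairFree (fun i _ => (hf i).dependsOn) (by simpa)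
      (Finset.mem_univ i) (Finset.mem_univ j) hij
  exact .of_pairFree hp (swap_eq_of_pairFree hp (by simpa))

theorem DeterminedByParity.gap_eq_two (hd : DeterminedByParity f) (hn : 4 ≤ n)
    (hf : ∀ i, IsEssential f i) : gap f = 2 := by
  have hnc : ¬ ∀ x y, f x = f y := by
    obtain ⟨x, a, h⟩ := hf ⟨0, by omega⟩
    exact fun hc => h (hc _ _)
  obtain ⟨i, j, hij, h⟩ := exists_gap_eq (by omega) hf
  rw [h, ess_eq_sub_of_essSet {i, j}, Finset.card_pair hij]
  · omega
  ext t
  simp only [Finset.coe_insert, Finset.coe_singleton, Set.mem_compl_iff, Set.mem_insert_iff,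
    Set.mem_singleton_iff, not_or]
  constructor
  · intro ht
    constructor
    · rintro rfl
      exact not_isEssential_minor_left hij ht
    · rintro rfl
      exact (pairFree_iff_not_isEssential hij).1 (hd.pairFree hij) ht
  · rintro ⟨hti, htj⟩
    by_contra hess
    exact hnc (hd.const_of_freeOn (by simpa) hti htj (freeOn_of_not_isEssential hess))

end GapTernary

/-! ### Symmetric differences as sums in `ℤ₂`, and counting occurrences. -/

section Indicator

variable {ι : Type*}

/-- The indicator function of a subset of `ℤ₃` with values in `ℤ₂`. -/
def ind (S : Finset (ZMod 3)) (e : ZMod 3) : ZMod 2 :=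
  if e ∈ S then 1 else 0

theorem ind_symmDiff (S T : Finset (ZMod 3)) (e : ZMod 3) : ind (S ∆ T) e = ind S e + ind T e := by
  simp only [ind, Finset.mem_symmDiff]
  by_cases h1 : e ∈ S <;> by_cases h2 : e ∈ T <;> simp [h1, h2]
  decide

theorem ind_singleton (a e : ZMod 3) : ind {a} e = if a = e then 1 else 0 := by
  simp [ind, eq_comm]

theorem ind_injective {S T : Finset (ZMod 3)} (h : ∀ e, ind S e = ind T e) : S = T := by
  ext e
  have := h e
  simp only [ind] at this
  split_ifs at this <;> simp_all

theorem ind_oplus (s : Finset ι) (v : ι → ZMod 3) (e : ZMod 3) :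
    ind (oplus s v) e = ∑ i ∈ s, if v i = e then 1 else 0 := by
  classical
  induction s using Finset.induction_on with
  | empty => simp [oplus, ind]
  | insert a s ha ih =>
    rw [Finset.sum_insert ha, ← ih, ← ind_singleton, ← ind_symmDiff, oplus, Finset.fold_insert ha,
      oplus]

variable [Fintype ι]

theorem sum_comp_eq {R : Type*} [CommRing R] (x : ι → ZMod 3) (F : ZMod 3 → R) :
    ∑ i, F (x i) = (∑ i, if x i = 0 then 1 else 0) * F 0 + (∑ i, if x i = 1 then 1 else 0) * F 1 +
      (∑ i, if x i = 2 then 1 else 0) * F 2 := by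
  have n01 : (0 : ZMod 3) ≠ 1 := by decide
  have n02 : (0 : ZMod 3) ≠ 2 := by decide
  have n12 : (1 : ZMod 3) ≠ 2 := by decide
  simp only [Finset.sum_mul, ← Finset.sum_add_distrib]
  refine Finset.sum_congr rfl fun i _ => ?_
  rcases (by decide : ∀ a : ZMod 3, a = 0 ∨ a = 1 ∨ a = 2) (x i) with h | h | h <;>
    simp [h, n01, n02, n12, n01.symm, n02.symm, n12.symm]

theorem sum_comp_eq_par (x : ι → ZMod 3) (F : ZMod 3 → ZMod 2) :
    ∑ i, F (x i) = par x 0 * F 0 + par x 1 * F 1 + par x 2 * F 2 :=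
  sum_comp_eq x F

/-- The number of occurrences of `c` in the tuple `x`, as an integer. -/
def occ (x : ι → ZMod 3) (c : ZMod 3) : ℤ :=
  ∑ i, if x i = c then 1 else 0

theorem cast_occ (x : ι → ZMod 3) (c : ZMod 3) : (occ x c : ZMod 2) = par x c := by
  simp [occ, par]

theorem occ_add_add (x : ι → ZMod 3) : occ x 0 + occ x 1 + occ x 2 = Fintype.card ι := by
  unfold occ
  rw [← Finset.sum_add_distrib, ← Finset.sum_add_distrib, Finset.sum_congr rfl (g := fun _ => 1)]
  · simp
  · intro i _
    generalize x i = a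
    revert a
    decide

theorem sum_comp_eq_occ (x : ι → ZMod 3) (F : ZMod 3 → ℤ) :
    ∑ i, F (x i) = occ x 0 * F 0 + occ x 1 * F 1 + occ x 2 * F 2 :=
  sum_comp_eq x F

/-- Integer values are essential for its use: the factor 2 has to be cancelled before reducing
modulo 2. -/
theorem two_mul_sum_lt [LinearOrder ι] (G : ι → ι → ℤ) (hG : ∀ i j, G i j = G j i) :
    2 * ∑ q : ι × ι with q.1 < q.2, G q.1 q.2 + ∑ i, G i i = ∑ i, ∑ j, G i j := by
  have h1 : ∑ q : ι × ι with q.1 < q.2, G q.1 q.2 = ∑ i, ∑ j, if i < j then G i j else 0 := by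
    rw [Finset.sum_filter, Fintype.sum_prod_type]
  have h2 : ∑ i, ∑ j, (if i < j then G i j else 0) = ∑ i, ∑ j, if j < i then G i j else 0 := by
    rw [Finset.sum_comm]
    simp only [hG]
  have h3 : ∑ i, G i i = ∑ i, ∑ j, if i = j then G i j else 0 := by simp
  rw [two_mul, h1]
  nth_rw 2 [h2]
  rw [h3]
  simp only [← Finset.sum_add_distrib]
  refine Finset.sum_congr rfl fun i _ => Finset.sum_congr rfl fun j _ => ?_
  rcases lt_trichotomy i j with h | h | h
  · simp [h, h.not_gt, h.ne]
  · simp [h]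
  · simp [h, h.not_gt, h.ne']

end Indicator

/-! ### The explicit formulas and the four parity patterns. -/

section Representation

variable {n : ℕ}

/-- Equal entries contribute `d`; distinct entries `a`, `b` contribute `p (a + b) + d` because `(a -
b) ^ 2 = 1`. The pairs of each kind are counted over `ℤ` and the count is reduced modulo 2. -/
theorem ind_pairSum (p : Polynomial (ZMod 3)) (d : ZMod 3) (x : Fin n → ZMod 3) (e : ZMod 3) :
    ind (pairSum p d x) e =
      par x 1 * par x 2 * (ind {p.eval 0 + d} e + ind {d} e) +
      par x 0 * par x 2 * (ind {p.eval 2 + d} e + ind {d} e) +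
      par x 0 * par x 1 * (ind {p.eval 1 + d} e + ind {d} e) + n.choose 2 * ind {d} e := by
  let G : ZMod 3 → ZMod 3 → ℤ := fun a b => if (a - b) ^ 2 * p.eval (a + b) + d = e then 1 else 0
  let D : ZMod 3 → ℤ := fun w => if w = e then 1 else 0
  have hD : ∀ w, ind {w} e = (D w : ZMod 2) := by
    intro w
    rw [ind_singleton]
    simp [D]
  have hG : ∀ a b, G a b = G b a := by
    intro a b
    simp only [G]
    rw [add_comm b a, ← neg_sub a b, neg_sq]
  have hdiag : ∀ a, G a a = D d := by simp [G, D]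
  have g01 : G 0 1 = D (p.eval 1 + d) := by
    simp [G, D]
  have g02 : G 0 2 = D (p.eval 2 + d) := by
    simp only [G, D, zero_add, show ((0 : ZMod 3) - 2) ^ 2 = 1 by decide, one_mul]
  have g12 : G 1 2 = D (p.eval 0 + d) := by
    simp only [G, D, show ((1 : ZMod 3) - 2) ^ 2 = 1 by decide, one_mul,
      show (1 : ZMod 3) + 2 = 0 by decide]
  have h2 := two_mul_sum_lt (fun i j => G (x i) (x j)) fun i j => hG _ _
  have hrow : ∀ a, ∑ j, G a (x j) = occ x 0 * G a 0 + occ x 1 * G a 1 + occ x 2 * G a 2 :=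
    fun a => sum_comp_eq_occ x (G a)
  simp only [hrow] at h2
  rw [sum_comp_eq_occ x (fun a => occ x 0 * G a 0 + occ x 1 * G a 1 + occ x 2 * G a 2),
    sum_comp_eq_occ x (fun a => G a a)] at h2
  simp only [hdiag, hG 1 0, hG 2 0, hG 2 1, g01, g02, g12] at h2
  have hn := occ_add_add x
  rw [Fintype.card_fin] at hn
  have hch : 2 * ((n.choose 2 : ℕ) : ℤ) = n * (n - 1) := by
    have := Nat.choose_two_right n
    have h := Nat.div_mul_cancel (even_iff_two_dvd.1 (Nat.even_mul_pred_self n))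
    rw [← this] at h
    rcases n with _ | n
    · simp
    · push_cast
      have := congrArg (Nat.cast (R := ℤ)) h
      push_cast at this
      linarith
  have hT : ∑ q : Fin n × Fin n with q.1 < q.2, G (x q.1) (x q.2) =
      occ x 1 * occ x 2 * (D (p.eval 0 + d) - D d) + occ x 0 * occ x 2 * (D (p.eval 2 + d) - D d) +
      occ x 0 * occ x 1 * (D (p.eval 1 + d) - D d) + (n.choose 2 : ℕ) * D d := by
    rw [← hn] at hch
    apply mul_left_cancel₀ (two_ne_zero (α := ℤ))
    linear_combination h2 - hch * D d
  have hT' := congrArg (Int.cast (R := ZMod 2)) hT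
  push_cast at hT'
  simp only [cast_occ, ← hD] at hT'
  simp only [CharTwo.sub_eq_add] at hT'
  rw [← hT', pairSum, ind_oplus]
  simp [G]

theorem ind_unarySum (p : Polynomial (ZMod 3)) (d : ZMod 3) (x : Fin n → ZMod 3) (e : ZMod 3) :
    ind (unarySum p d x) e = par x 0 * ind {p.eval 0 + d} e + par x 1 * ind {p.eval 1 + d} e +
      par x 2 * ind {p.eval 2 + d} e := by
  rw [unarySum, ind_oplus, sum_comp_eq_par x fun a => if p.eval a + d = e then 1 else 0]
  simp only [ind_singleton]

/-- The indicator of the expression that represents a function, in terms of the parities `u`, the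
values `P` of the polynomial, and the constant `d`; `N` is the arity modulo `2`. -/
def repInd (N : ZMod 2) (u : ZMod 3 → ZMod 2) (P : ZMod 3 → ZMod 3) (d e : ZMod 3) : ZMod 2 :=
  u 1 * u 2 * (ind {P 0 + d} e + ind {d} e) + u 0 * u 2 * (ind {P 2 + d} e + ind {d} e) +
    u 0 * u 1 * (ind {P 1 + d} e + ind {d} e) + (N + 1) * ind {d} e +
    N * (u 0 * ind {P 0 + d} e + u 1 * ind {P 1 + d} e + u 2 * ind {P 2 + d} e)

theorem cast_choose_two (n : ℕ) : ((n.choose 2 : ℕ) : ZMod 2) =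
    if n % 4 = 0 ∨ n % 4 = 1 then 0 else 1 := by
  have step : ∀ m : ℕ, (((m + 1).choose 2 : ℕ) : ZMod 2) = m + (m.choose 2 : ℕ) := by
    intro m
    rw [Nat.choose_succ_succ' m 1, Nat.choose_one_right]
    push_cast
    ring
  have four : ∀ m : ℕ, (((m + 4).choose 2 : ℕ) : ZMod 2) = (m.choose 2 : ℕ) := by
    intro m
    rw [step, step, step, step]
    push_cast
    linear_combination (2 * m + 3 : ZMod 2) * CharTwo.two_eq_zero (R := ZMod 2)
  have mul : ∀ k r : ℕ, (((4 * k + r).choose 2 : ℕ) : ZMod 2) = (r.choose 2 : ℕ) := by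
    intro k r
    induction k with
    | zero => simp
    | succ k ih => rw [show 4 * (k + 1) + r = 4 * k + r + 4 by ring, four, ih]
  rw [← Nat.div_add_mod n 4, mul]
  have : n % 4 < 4 := Nat.mod_lt _ (by norm_num)
  interval_cases h : n % 4 <;> simp [Nat.choose]
  decide

theorem cast_eq_ite (n : ℕ) : (n : ZMod 2) = if n % 4 = 0 ∨ n % 4 = 2 then 0 else 1 := by
  have : (n : ZMod 2) = ((n % 4 : ℕ) : ZMod 2) := by
    rw [ZMod.natCast_eq_natCast_iff]
    exact ((Nat.mod_modEq n 4).of_dvd (by norm_num)).symm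
  rw [this]
  have : n % 4 < 4 := Nat.mod_lt _ (by norm_num)
  interval_cases n % 4 <;> decide

/-- The extra terms `d` in the cases 0 and 3 modulo 4 correct the parity of `n.choose 2`, so that
the four formulas become one depending on `n` modulo 2. -/
theorem represents_iff {p : Polynomial (ZMod 3)} {d : ZMod 3} {f : (Fin n → ZMod 3) → ZMod 3} :
    Represents p d f ↔ (∃ a b c : ZMod 3, p = .C a * .X ^ 2 + .C b * .X + .C c) ∧
      ∀ x e, ind {f x} e = repInd n (par x) (fun t => p.eval t) d e := by
  have key : ∀ R : (Fin n → ZMod 3) → Finset (ZMod 3),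
      (∀ x e, ind (R x) e = repInd n (par x) (fun t => p.eval t) d e) →
      ((∀ x, {f x} = R x) ↔ ∀ x e, ind {f x} e = repInd n (par x) (fun t => p.eval t) d e) := by
    intro R hR
    constructor
    · intro h x e
      rw [h, hR]
    · intro h x
      exact ind_injective fun e => by rw [h, hR]
  have hc := cast_choose_two n
  have hn := cast_eq_ite n
  unfold Represents
  refine and_congr_right fun _ => ?_
  have two : (2 : ZMod 2) = 0 := rfl
  rcases (by omega : n % 4 = 0 ∨ n % 4 = 1 ∨ n % 4 = 2 ∨ n % 4 = 3) with h | h | h | h <;>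
    simp only [h] at hc hn ⊢ <;>
    norm_num at hc hn ⊢ <;>
    apply key <;> intro x e <;>
    simp only [repInd, ind_symmDiff, ind_pairSum, ind_unarySum, hc, hn]
  · ring
  · linear_combination (-ind {d} e) * two
  · ring
  · ring

/-- Tuples at which a represented function takes the values `p t + d` and `d`. -/
theorem exists_reference_tuples (hn : 2 ≤ n) :
    ∃ (xs : ZMod 3 → Fin n → ZMod 3) (xd : Fin n → ZMod 3),
      (∀ t P d e, repInd n (par (xs t)) P d e = ind {P t + d} e) ∧
      (∀ P d e, repInd n (par xd) P d e = ind {d} e) ∧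
      ∀ x : Fin n → ZMod 3, (∃ t, ∀ c, par x c = par (xs t) c) ∨ ∀ c, par x c = par xd c := by
  have hrs : (⟨0, by omega⟩ : Fin n) ≠ ⟨1, by omega⟩ := by simp
  have hpar := par_twoEntries hrs
  generalize twoEntries (⟨0, by omega⟩ : Fin n) ⟨1, by omega⟩ = T at hpar
  rw [Fintype.card_fin] at hpar
  have hsum : ∀ x : Fin n → ZMod 3, par x 0 + par x 1 + par x 2 = (n : ZMod 2) := by
    intro x
    rw [par_add_add, Fintype.card_fin]
  have ext3 : ∀ u v : ZMod 3 → ZMod 2, u 0 = v 0 → u 1 = v 1 → u 2 = v 2 → ∀ c, u c = v c := by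
    intro u v h0 h1 h2 c
    fin_cases c
    · exact h0
    · exact h1
    · exact h2
  -- The sum of the parities is `N`, leaving four patterns. The value `d` belongs to the constant
  -- one: all even for `N = 0`, all odd for `N = 1`.
  rcases (by decide : ∀ N : ZMod 2, N = 0 ∨ N = 1) (n : ZMod 2) with hN | hN
  · rw [hN] at hpar hsum ⊢
    have v : ∀ t c, par (![T 1 2, T 1 0, T 2 0] t) c = ![![0, 1, 1], ![1, 1, 0], ![1, 0, 1]] t c := by
      intro t
      fin_cases t
      all_goals
        refine ext3 _ _ ?_ ?_ ?_ <;> refine (hpar _ _ _).trans ?_ <;> decide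
    have vd : ∀ c, par (T 0 0) c = ![0, 0, 0] c := by
      refine ext3 _ _ ?_ ?_ ?_ <;> refine (hpar _ _ _).trans ?_ <;> decide
    refine ⟨![T 1 2, T 1 0, T 2 0], T 0 0, fun t P d e => ?_, fun P d e => ?_, fun x => ?_⟩
    · rw [funext (v t)]
      have ht : ind {P t + d} e =
          ![ind {P 0 + d} e, ind {P 1 + d} e, ind {P 2 + d} e] t := by
        fin_cases t <;> rfl
      rw [ht]
      simp only [repInd]
      generalize ind {P 0 + d} e = a₀, ind {P 1 + d} e = a₁, ind {P 2 + d} e = a₂, ind {d} e = b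
      clear ht
      revert t a₀ a₁ a₂ b
      decide
    · rw [funext vd]
      simp only [repInd]
      generalize ind {P 0 + d} e = a₀, ind {P 1 + d} e = a₁, ind {P 2 + d} e = a₂, ind {d} e = b
      revert a₀ a₁ a₂ b
      decide
    · have key : ∀ u v w : ZMod 2, u + v + w = 0 →
        (u = 0 ∧ v = 1 ∧ w = 1) ∨
        (u = 1 ∧ v = 1 ∧ w = 0) ∨
        (u = 1 ∧ v = 0 ∧ w = 1) ∨
        (u = 0 ∧ v = 0 ∧ w = 0) := by decide
      rcases key _ _ _ (hsum x) with ⟨h0, h1, h2⟩ | ⟨h0, h1, h2⟩ | ⟨h0, h1, h2⟩ | ⟨h0, h1, h2⟩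
      · exact .inl ⟨0, fun c => .trans (ext3 _ ![0, 1, 1] h0 h1 h2 c) (v 0 c).symm⟩
      · exact .inl ⟨1, fun c => .trans (ext3 _ ![1, 1, 0] h0 h1 h2 c) (v 1 c).symm⟩
      · exact .inl ⟨2, fun c => .trans (ext3 _ ![1, 0, 1] h0 h1 h2 c) (v 2 c).symm⟩
      · exact .inr fun c => .trans (ext3 _ ![0, 0, 0] h0 h1 h2 c) (vd c).symm
  · rw [hN] at hpar hsum ⊢
    have v : ∀ t c, par (![T 0 0, T 1 0, T 2 0] t) c = ![![1, 0, 0], ![0, 1, 0], ![0, 0, 1]] t c := by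
      intro t
      fin_cases t
      all_goals
        refine ext3 _ _ ?_ ?_ ?_ <;> refine (hpar _ _ _).trans ?_ <;> decide
    have vd : ∀ c, par (T 1 2) c = ![1, 1, 1] c := by
      refine ext3 _ _ ?_ ?_ ?_ <;> refine (hpar _ _ _).trans ?_ <;> decide
    refine ⟨![T 0 0, T 1 0, T 2 0], T 1 2, fun t P d e => ?_, fun P d e => ?_, fun x => ?_⟩
    · rw [funext (v t)]
      have ht : ind {P t + d} e =
          ![ind {P 0 + d} e, ind {P 1 + d} e, ind {P 2 + d} e] t := by
        fin_cases t <;> rfl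
      rw [ht]
      simp only [repInd]
      generalize ind {P 0 + d} e = a₀, ind {P 1 + d} e = a₁, ind {P 2 + d} e = a₂, ind {d} e = b
      clear ht
      revert t a₀ a₁ a₂ b
      decide
    · rw [funext vd]
      simp only [repInd]
      generalize ind {P 0 + d} e = a₀, ind {P 1 + d} e = a₁, ind {P 2 + d} e = a₂, ind {d} e = b
      revert a₀ a₁ a₂ b
      decide
    · have key : ∀ u v w : ZMod 2, u + v + w = 1 →
        (u = 1 ∧ v = 0 ∧ w = 0) ∨
        (u = 0 ∧ v = 1 ∧ w = 0) ∨
        (u = 0 ∧ v = 0 ∧ w = 1) ∨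
        (u = 1 ∧ v = 1 ∧ w = 1) := by decide
      rcases key _ _ _ (hsum x) with ⟨h0, h1, h2⟩ | ⟨h0, h1, h2⟩ | ⟨h0, h1, h2⟩ | ⟨h0, h1, h2⟩
      · exact .inl ⟨0, fun c => .trans (ext3 _ ![1, 0, 0] h0 h1 h2 c) (v 0 c).symm⟩
      · exact .inl ⟨1, fun c => .trans (ext3 _ ![0, 1, 0] h0 h1 h2 c) (v 1 c).symm⟩
      · exact .inl ⟨2, fun c => .trans (ext3 _ ![0, 0, 1] h0 h1 h2 c) (v 2 c).symm⟩
      · exact .inr fun c => .trans (ext3 _ ![1, 1, 1] h0 h1 h2 c) (vd c).symm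

variable {p p' : Polynomial (ZMod 3)} {d d' : ZMod 3} {f : (Fin n → ZMod 3) → ZMod 3}

theorem Represents.determinedByParity (h : Represents p d f) : DeterminedByParity f := by
  intro x y hxy
  have h := (represents_iff.1 h).2
  exact Finset.singleton_injective (ind_injective fun e => by rw [h, h, funext hxy])

theorem eval_quadratic (a b c t : ZMod 3) :
    (.C a * .X ^ 2 + .C b * .X + .C c : Polynomial (ZMod 3)).eval t = a * t ^ 2 + b * t + c := by
  simp

theorem DeterminedByParity.exists_represents (hf : DeterminedByParity f) (hn : 2 ≤ n) :
    ∃ p d, Represents p d f := by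
  obtain ⟨xs, xd, h1, h2, h3⟩ := exists_reference_tuples hn
  have interp : ∀ v w z : ZMod 3, ∃ a b c : ZMod 3, a * 0 ^ 2 + b * 0 + c = v ∧
      a * 1 ^ 2 + b * 1 + c = w ∧ a * 2 ^ 2 + b * 2 + c = z := by decide
  obtain ⟨a, b, c, e0, e1, e2⟩ :=
    interp (f (xs 0) - f xd) (f (xs 1) - f xd) (f (xs 2) - f xd)
  refine ⟨.C a * .X ^ 2 + .C b * .X + .C c, f xd, represents_iff.2 ⟨⟨a, b, c, rfl⟩, ?_⟩⟩
  intro x e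
  rcases h3 x with ⟨t, ht⟩ | hx
  · rw [hf _ _ ht, funext ht, h1, eval_quadratic]
    congr
    rw [← sub_eq_iff_eq_add]
    fin_cases t
    · exact e0.symm
    · exact e1.symm
    · exact e2.symm
  · rw [hf _ _ hx, funext hx, h2]

theorem Represents.unique (hn : 2 ≤ n) (h : Represents p d f) (h' : Represents p' d' f) :
    p = p' ∧ d = d' := by
  obtain ⟨xs, xd, h1, h2, -⟩ := exists_reference_tuples hn
  obtain ⟨⟨a, b, c, rfl⟩, h⟩ := represents_iff.1 h
  obtain ⟨⟨a', b', c', rfl⟩, h'⟩ := represents_iff.1 h'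
  have hd : d = d' := by
    simpa using ind_injective fun e =>
      ((h2 _ d e).symm.trans (h xd e).symm).trans ((h' xd e).trans (h2 _ d' e))
  have hp : ∀ t : ZMod 3, a * t ^ 2 + b * t + c = a' * t ^ 2 + b' * t + c' := by
    intro t
    have := ind_injective fun e =>
      ((h1 t _ d e).symm.trans (h (xs t) e).symm).trans ((h' (xs t) e).trans (h1 t _ d' e))
    rw [hd] at this
    simpa using this
  have h0 := hp 0
  have h1 := hp 1
  have h2 := hp 2
  have key : ∀ v w z : ZMod 3, v * 0 ^ 2 + w * 0 + z = 0 → v * 1 ^ 2 + w * 1 + z = 0 →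
      v * 2 ^ 2 + w * 2 + z = 0 → v = 0 ∧ w = 0 ∧ z = 0 := by decide
  obtain ⟨k1, k2, k3⟩ := key (a - a') (b - b') (c - c') (by linear_combination h0)
    (by linear_combination h1) (by linear_combination h2)
  rw [sub_eq_zero.1 k1, sub_eq_zero.1 k2, sub_eq_zero.1 k3]
  exact ⟨rfl, hd⟩

end Representation

end ArityGap

theorem mainTheorem6 (n : ℕ) (hn : 4 ≤ n) (f : (Fin n → ZMod 3) → ZMod 3)
    (hf : ∀ i, ArityGap.IsEssential f i) :
    (ArityGap.gap f = 2 ↔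
      ∃ (p : Polynomial (ZMod 3)) (d : ZMod 3), ArityGap.Represents p d f) ∧
    (∀ (p p' : Polynomial (ZMod 3)) (d d' : ZMod 3),
      ArityGap.Represents p d f → ArityGap.Represents p' d' f → p = p' ∧ d = d') ∧
    (ArityGap.gap f ≠ 2 → ArityGap.gap f = 1) := by
  have hdet := ArityGap.determinedByParity_of_gap_ne_one hn hf
  refine ⟨⟨fun h => ?_, ?_⟩, fun p p' d d' => ArityGap.Represents.unique (by omega), fun h => ?_⟩
  · exact (hdet (by omega)).exists_represents (by omega)
  · rintro ⟨p, d, h⟩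
    exact h.determinedByParity.gap_eq_two hn hf
  · by_contra h1
    exact h ((hdet h1).gap_eq_two hn hf)
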